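/- **Setting.** A stochastic reachability game with active sensing and sensor attacks is $G=(S,A_1,\Sigma,\Gamma_1,\Gamma_2,\mathbf P,O,\mathsf{Obs},s_0,o_0,F)$, where $S$ (states), $A_1$ (control actions) and $\Sigma$ (sensors) are finite, $\Gamma_1,\Gamma_2\subseteq 2^\Sigma$ are the sensor queries of P1 and the sensor attacks of P2, $\mathbf P:S\times A_1\to\mathcal D(S)$ is the transition function ($\mathcal D(X)$ denotes the probability distributions on $X$), $O\subseteq 2^S$, $\mathsf{Obs}:S\times\Gamma_1\times\Gamma_2\to O$, $s_0\in S$, $o_0\in O$ with $s_0\in o_0$, and $F\subseteq S$. In round $i=0,1,\dots$, P1 chooses $(a_i,\gamma_1^i)\in A_1\times\Gamma_1$, the next state $s_{i+1}$ is drawn from $\mathbf P(s_i,a_i,\cdot)$, and P2, who sees everything, chooses $\gamma_2^i\in\Gamma_2$; P1 then observes $o_{i+1}=\mathsf{Obs}(s_{i+1},\gamma_1^i,\gamma_2^i)$. A strategy of a player is a map from play prefixes (for P2, including P1's action and the new state of the current round) to distributions over the player's actions. A strategy of P1 is observation-based if it agrees on any two prefixes that have the same observation $o_0(a_0,\gamma_1^0,\gamma_2^0)o_1(a_1,\gamma_1^1,\gamma_2^1)o_2\cdots$.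 A sensor $\sigma_0\in\Sigma$ is hidden from P2, and P2's delay in reaction is $\tau\in\mathbb N$: in round $k$ P2 may choose $\gamma_2\in\Gamma_2$ with $\sigma_0\in\gamma_2$ only if $\sigma_0\in\gamma_1^t$ for some $t$ with $0\le t$ and $t+\tau\le k$. Some $\gamma_2\in\Gamma_2$ does not contain $\sigma_0$, so that P2 always has an available attack. A strategy $\pi_1$ of P1 is almost-sure winning in $G$ from a prefix $\rho$ if, against every strategy of P2 that obeys this restriction, the play that continues $\rho$ visits $F$ (at a state of $\rho$ or later) with probability one. **Sensor-revealing game.** Put $\mathsf{Post}_G(B,a)=\{s'\mid\exists s\in B:\mathbf P(s,a,s')>0\}$, and fix $\epsilon\in(0,1)$ and $B_0\subseteq S$ (for instance $B_0=o_0$). The game $\mathcal H$ has P1 states $(s,B,\kappa)$, nature states $(s,B,a,\gamma_1,\kappa)$, P2 states $(s,B,\gamma_1,\kappa)$, with $s\in S$, $B\subseteq S$, $a\in A_1$, $\gamma_1\in\Gamma_1$, $\kappa\in\{-1,0,\dots,\tau\}$, and a sink $q_F$; its initial state is $q_0=(s_0,B_0,-1)$. - At $(s,B,\kappa)$, P1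 chooses $(a,\gamma_1)\in A_1\times\Gamma_1$ and the game moves to $(s,\mathsf{Post}_G(B,a),a,\gamma_1,\kappa')$, where $\kappa'=\kappa$ if $\kappa=\tau$, or if $\kappa=-1$ and $\sigma_0\notin\gamma_1$; and $\kappa'=\kappa+1$ otherwise. - At $(s,B,a,\gamma_1,\kappa)$, let $R=\mathsf{Post}_G(\{s\},a)$. If $R\subseteq F$, the game moves to $q_F$. If $R\cap F=\emptyset$, it moves to $(s',B,\gamma_1,\kappa)$ with probability $\mathbf P(s,a,s')$. Otherwise it moves to $q_F$ with probability $\epsilon$ and to $(s',B,\gamma_1,\kappa)$ with probability $(1-\epsilon)\mathbf P(s,a,s')$. - At $(s,B,\gamma_1,\kappa)$, P2 chooses $\gamma_2\in\Gamma_2$, with $\sigma_0\notin\gamma_2$ if $\kappa<\tau$, and the game moves to $(s,B\cap\mathsf{Obs}(s,\gamma_1,\gamma_2),\kappa)$. A belief-based strategy $\pi$ of P1 in $\mathcal H$ maps P1 states to $\mathcal D(A_1\times\Gamma_1)$, with $\pi(s,B,\kappa)=\pi(s',B,\kappa)$ for all $s,s',B,\kappa$. It is almost-sure winning from $q$ if,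 against every (randomized, history-dependent) strategy of P2 in $\mathcal H$, the play from $q$ reaches $q_F$ with probability one. A prefix $\rho$ of a play in $G$ determines the P1 state $q(\rho)=(s(\rho),B(\rho),\kappa(\rho))$, where $s(\rho)$ is its last state and $B(\rho)$, $\kappa(\rho)$ result from $B_0$ and $-1$ by the updates above; $q(\rho)=q_0$ for the prefix $\rho=s_0$. In $G$, P1 uses $\pi$ by choosing his action after $\rho$ according to $\pi(q(\rho))$. **Lemma.** Let $\pi$ be a belief-based strategy of P1 in $\mathcal H$. Used in $G$, $\pi$ is observation-based. If $\pi$ is almost-sure winning to reach $q_F$ in $\mathcal H$ from $q_0$, then, used in $G$, $\pi$ is almost-sure winning for P1 to visit $F$ from $s_0$. More generally, for every prefix $\rho$ of $G$, if $\pi$ is almost-sure winning in $\mathcal H$ from $q(\rho)$, then, used in $G$, $\pi$ is almost-sure winning to visit $F$ from $\rho$. -/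

import Mathlib

open MeasureTheory ProbabilityTheory
open scoped NNReal ENNReal

namespace SensorGame

/-! ### The random infinite word generated by a history-dependent rule -/

section Word

variable {X : Type*} [Finite X] [MeasurableSpace X] [DiscreteMeasurableSpace X]

/-- The law of the letter number `n + 1` given the letters number `0, …, n`, when `next` maps every
finite word to the distribution of the letter that follows it. -/
noncomputable def nextKernel (next : List X → PMF X) (n : ℕ) :
    Kernel (Π _ : Finset.Iic n, X) X where
  toFun x := (next (List.ofFn fun i : Fin (n + 1) =>
    x ⟨i.1, Finset.mem_Iic.2 (Nat.lt_succ_iff.1 i.2)⟩)).toMeasure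
  measurable' := Measurable.of_discrete

instance nextKernel_markov (next : List X → PMF X) (n : ℕ) :
    IsMarkovKernel (nextKernel next n) :=
  ⟨fun _ => PMF.toMeasure.isProbabilityMeasure _⟩

/-- The law (Ionescu-Tulcea) of the random infinite word whose letters are drawn one after the
other, the letter that follows the finite word `h` being drawn from `next h`. -/
noncomputable def wordLaw (next : List X → PMF X) : Measure (ℕ → X) :=
  Kernel.trajMeasure (X := fun _ => X) (next []).toMeasure (nextKernel next)

end Word

/-! ### The game with active sensing and sensor attacks -/

/-- A two-player stochastic reachability game with active sensing and sensor attacks, with set of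
states `S`, set of control actions `A` (of player 1) and set of sensors `Sens`. -/
structure Game (S A Sens : Type*) where
  /-- sensor query actions of player 1 -/
  Γ₁ : Set (Set Sens)
  /-- sensor attack actions of player 2 -/
  Γ₂ : Set (Set Sens)
  /-- probabilistic transition function -/
  P : S → A → PMF S
  /-- observations -/
  O : Set (Set S)
  /-- observation function of player 1 -/
  Obs : S → Γ₁ → Γ₂ → O
  /-- initial state -/
  s₀ : S
  /-- initial observation -/
  o₀ : O
  s₀_mem : s₀ ∈ o₀.1
  /-- goal states -/
  F : Set S

namespace Game

variable {S A Sens : Type*}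

/-- One round of play: player 1 takes the control action `act` and the sensor query `query`, the
state becomes `state`, and then player 2 takes the sensor attack `attack`. -/
structure Round (G : Game S A Sens) where
  act : A
  query : G.Γ₁
  state : S
  attack : G.Γ₂

variable (G : Game S A Sens)

instance : MeasurableSpace G.Round := ⊤
instance : DiscreteMeasurableSpace G.Round := ⟨fun _ => trivial⟩
instance [Finite S] [Finite A] [Finite Sens] : Finite G.Round :=
  Finite.of_injective (fun r : G.Round => (r.act, r.query, r.state, r.attack)) (by
    rintro ⟨⟩ ⟨⟩ h; simp_all)

/-- A play prefix `s₀ (a₀, γ₁⁰) s₁ γ₂⁰ (a₁, γ₁¹) s₂ γ₂¹ … s_k γ₂^{k-1}` at which it is player 1's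
turn. It starts in the initial state `G.s₀`, so it is given by the list of its rounds. -/
abbrev Pref := List G.Round

/-- The state reached at the end of a play prefix. -/
def lastState (ρ : G.Pref) : S := (ρ.getLast?.map Round.state).getD G.s₀

/-- Player 1's observation `o₀ (a₀, γ₁⁰, γ₂⁰) o₁ (a₁, γ₁¹, γ₂¹) o₂ …` of a play prefix. -/
def observation (ρ : G.Pref) : G.O × List (A × G.Γ₁ × G.Γ₂ × G.O) :=
  (G.o₀, ρ.map fun r => (r.act, r.query, r.attack, G.Obs r.state r.query r.attack))

/-- Randomized, history-dependent strategies of player 1. -/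
abbrev Strategy₁ := G.Pref → PMF (A × G.Γ₁)

/-- Randomized, history-dependent strategies of player 2: in the current round, after the prefix
`ρ`, she has seen player 1's action `(a, γ₁)` and the new state when she chooses her attack. -/
abbrev Strategy₂ := G.Pref → A → G.Γ₁ → S → PMF G.Γ₂

/-- A strategy of player 1 is observation-based if it takes the same decision after any two
observation-equivalent prefixes. -/
def ObservationBased (π₁ : G.Strategy₁) : Prop :=
  ∀ ρ ρ' : G.Pref, G.observation ρ = G.observation ρ' → π₁ ρ = π₁ ρ'

/-- The strategies that player 2 can carry out when the sensor `σ₀` is hidden from her and her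
delay in reaction is `τ`: in a round (the current one is number `ρ.length`) she can use an attack
on `σ₀` only if player 1 queried, and thereby revealed, `σ₀` at least `τ` rounds earlier. -/
def Admissible (σ₀ : Sens) (τ : ℕ) (π₂ : G.Strategy₂) : Prop :=
  ∀ (ρ : G.Pref) (a : A) (γ₁ : G.Γ₁) (s : S), ∀ γ₂ ∈ (π₂ ρ a γ₁ s).support, σ₀ ∈ γ₂.1 →
    ∃ t, t + τ ≤ ρ.length ∧ ∃ γ ∈ (ρ.map Round.query ++ [γ₁])[t]?, σ₀ ∈ γ.1

/-- The distribution of the round that follows the prefix `ρ` under a strategy profile. -/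
noncomputable def nextRound (π₁ : G.Strategy₁) (π₂ : G.Strategy₂) (ρ : G.Pref) : PMF G.Round :=
  (π₁ ρ).bind fun c => (G.P (G.lastState ρ) c.1).bind fun s' =>
    (π₂ ρ c.1 c.2 s').map fun γ₂ => ⟨c.1, c.2, s', γ₂⟩

/-- The play that continues the prefix `ρ` by the rounds `w 0, w 1, …` visits `F`. -/
def Visits (ρ : G.Pref) (w : ℕ → G.Round) : Prop :=
  G.s₀ ∈ G.F ∨ (∃ r ∈ ρ, r.state ∈ G.F) ∨ ∃ n, (w n).state ∈ G.F

/-- From the prefix `ρ` on, the strategy `π₁` is almost-sure winning for player 1 to visit `F`,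
against every strategy that player 2 can carry out, the sensor `σ₀` being hidden from her and her
delay in reaction being `τ`. -/
def AlmostSureWinning [Finite S] [Finite A] [Finite Sens] (σ₀ : Sens) (τ : ℕ)
    (π₁ : G.Strategy₁) (ρ : G.Pref) : Prop :=
  ∀ π₂ : G.Strategy₂, G.Admissible σ₀ τ π₂ →
    ∀ᵐ w ∂(wordLaw fun h => G.nextRound π₁ π₂ (ρ ++ h)), G.Visits ρ w

/-- The states that may be reached from a state of `B` by the control action `a`. -/
def Post (B : Set S) (a : A) : Set S := {s' | ∃ s ∈ B, 0 < G.P s a s'}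

end Game

/-! ### The sensor-revealing game -/

/-- The values `κ ∈ {-1, 0, …, τ}`. -/
abbrev Counter (τ : ℕ) := Set.Icc (-1 : ℤ) (τ : ℤ)

/-- The value `-1`: the hidden sensor has not been revealed. -/
def Counter.unrevealed (τ : ℕ) : Counter τ := ⟨-1, le_rfl, by omega⟩

open Classical in
/-- The counter after a sensor query `γ₁`. -/
noncomputable def Counter.update {Sens : Type*} (σ₀ : Sens) {τ : ℕ} (κ : Counter τ)
    (γ₁ : Set Sens) : Counter τ :=
  if h : κ.1 = τ then κ
  else if κ.1 = -1 ∧ σ₀ ∉ γ₁ then κ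
  else ⟨κ.1 + 1, by have h₁ := κ.2.1; have h₂ := κ.2.2; constructor <;> omega⟩

namespace Game

variable {S A Sens : Type*}

/-- The states `Q₁ ∪ Q_N ∪ Q₂ ∪ {q_F}` of the sensor-revealing game with delay `τ`. -/
inductive HState (G : Game S A Sens) (τ : ℕ) where
  | p1 (s : S) (B : Set S) (κ : Counter τ)
  | nature (s : S) (B : Set S) (a : A) (γ₁ : G.Γ₁) (κ : Counter τ)
  | p2 (s : S) (B : Set S) (γ₁ : G.Γ₁) (κ : Counter τ)
  | final

/-- What happens in one transition of the sensor-revealing game: an action of player 1, an attack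
of player 2, or a move of nature. -/
inductive HMove (G : Game S A Sens) where
  | control (a : A) (γ₁ : G.Γ₁)
  | attack (γ₂ : G.Γ₂)
  | chance

/-- One transition of the sensor-revealing game: the move and the state that it leads to. -/
structure HStep (G : Game S A Sens) (τ : ℕ) where
  move : G.HMove
  state : G.HState τ

variable (G : Game S A Sens) {τ : ℕ}

instance [Finite S] [Finite A] [Finite Sens] : Finite (G.HState τ) :=
  Finite.of_injective
    (β := (S × Set S × Counter τ) ⊕ (S × Set S × A × G.Γ₁ × Counter τ) ⊕
      (S × Set S × G.Γ₁ × Counter τ) ⊕ Unit)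
    (fun q => match q with
      | .p1 s B κ => .inl (s, B, κ)
      | .nature s B a γ₁ κ => .inr (.inl (s, B, a, γ₁, κ))
      | .p2 s B γ₁ κ => .inr (.inr (.inl (s, B, γ₁, κ)))
      | .final => .inr (.inr (.inr ())))
    (by intro q q' h; cases q <;> cases q' <;> simp_all)

instance [Finite A] [Finite Sens] : Finite G.HMove :=
  Finite.of_injective (β := (A × G.Γ₁) ⊕ G.Γ₂ ⊕ Unit)
    (fun m => match m with
      | .control a γ₁ => .inl (a, γ₁)
      | .attack γ₂ => .inr (.inl γ₂)
      | .chance => .inr (.inr ()))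
    (by intro q q' h; cases q <;> cases q' <;> simp_all)

instance [Finite S] [Finite A] [Finite Sens] : Finite (G.HStep τ) :=
  Finite.of_injective (fun r : G.HStep τ => (r.move, r.state)) (by
    rintro ⟨⟩ ⟨⟩ h; simp_all)

instance : MeasurableSpace (G.HStep τ) := ⊤
instance : DiscreteMeasurableSpace (G.HStep τ) := ⟨fun _ => trivial⟩

/-- The distribution on `Bool` that gives probability `ε` to `true`. -/
noncomputable def coin (ε : ℝ≥0) (hε : ε ≤ 1) : PMF Bool :=
  PMF.ofFintype (fun b => ((if b then ε else 1 - ε : ℝ≥0) : ℝ≥0∞)) (by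
    rw [Fintype.sum_bool]; simp [hε])

/-- Transition from a state of player 1 under his action `(a, γ₁)`. -/
noncomputable def δ₁ (σ₀ : Sens) (s : S) (B : Set S) (κ : Counter τ) (a : A) (γ₁ : G.Γ₁) :
    PMF (G.HState τ) :=
  PMF.pure (.nature s (G.Post B a) a γ₁ (Counter.update σ₀ κ γ₁.1))

open Classical in
/-- Transition from a state of nature. In the mixed case the final state has probability `ε`, and
`(s', B, γ₁, κ)` has probability `(1 - ε) * P(s, a, s')`. -/
noncomputable def δN (ε : ℝ≥0) (hε : ε ≤ 1) (s : S) (B : Set S) (a : A) (γ₁ : G.Γ₁)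
    (κ : Counter τ) : PMF (G.HState τ) :=
  if G.Post {s} a ⊆ G.F then PMF.pure .final
  else if G.Post {s} a ∩ G.F = ∅ then (G.P s a).map fun s' => .p2 s' B γ₁ κ
  else (coin ε hε).bind fun b =>
    if b then PMF.pure .final else (G.P s a).map fun s' => .p2 s' B γ₁ κ

/-- Transition from a state of player 2 under her attack `γ₂`. -/
noncomputable def δ₂ (s : S) (B : Set S) (γ₁ : G.Γ₁) (κ : Counter τ) (γ₂ : G.Γ₂) :
    PMF (G.HState τ) :=
  PMF.pure (.p1 s (B ∩ (G.Obs s γ₁ γ₂).1) κ)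

/-- The initial state `(s₀, B₀, -1)` of the sensor-revealing game. -/
def initialH (τ : ℕ) (B₀ : Set S) : G.HState τ := .p1 G.s₀ B₀ (Counter.unrevealed τ)

/-- Randomized strategies of player 1 that depend on the current state `(s, B, κ)` only. -/
abbrev HStrategy₁ (τ : ℕ) := S → Set S → Counter τ → PMF (A × G.Γ₁)

/-- A strategy of player 1 is belief-based if it takes the same decision at any two states
`(s, B, κ)`, `(s', B, κ)`. -/
def BeliefBased (π : G.HStrategy₁ τ) : Prop :=
  ∀ (s s' : S) (B : Set S) (κ : Counter τ), π s B κ = π s' B κ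

/-- The state reached from `q` by the transitions in the list `h`. -/
def lastH (q : G.HState τ) (h : List (G.HStep τ)) : G.HState τ :=
  (h.getLast?.map HStep.state).getD q

/-- Randomized, history-dependent strategies of player 2 in the sensor-revealing game, for the
plays that start in a given state; only the values at histories that end in a state of player 2
matter. -/
abbrev HStrategy₂ (τ : ℕ) := List (G.HStep τ) → PMF G.Γ₂

/-- A strategy of player 2 (for the plays from `q`) obeys the rules of the sensor-revealing game if
at states `(s, B, γ₁, κ)` with `κ < τ` it uses only attacks that do not contain `σ₀`. -/
def HLegal (σ₀ : Sens) (q : G.HState τ) (π₂ : G.HStrategy₂ τ) : Prop :=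
  ∀ (h : List (G.HStep τ)) (s : S) (B : Set S) (γ₁ : G.Γ₁) (κ : Counter τ),
    G.lastH q h = .p2 s B γ₁ κ → κ.1 < τ → ∀ γ₂ ∈ (π₂ h).support, σ₀ ∉ γ₂.1

/-- The distribution of the next transition after the history `h` from `q`. -/
noncomputable def nextHStep (σ₀ : Sens) (ε : ℝ≥0) (hε : ε ≤ 1) (π : G.HStrategy₁ τ)
    (π₂ : G.HStrategy₂ τ) (q : G.HState τ) (h : List (G.HStep τ)) : PMF (G.HStep τ) :=
  match G.lastH q h with
  | .p1 s B κ => (π s B κ).bind fun c =>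
      (G.δ₁ σ₀ s B κ c.1 c.2).map fun q' => ⟨.control c.1 c.2, q'⟩
  | .nature s B a γ₁ κ => (G.δN ε hε s B a γ₁ κ).map fun q' => ⟨.chance, q'⟩
  | .p2 s B γ₁ κ => (π₂ h).bind fun γ₂ =>
      (G.δ₂ s B γ₁ κ γ₂).map fun q' => ⟨.attack γ₂, q'⟩
  | .final => PMF.pure ⟨.chance, .final⟩

/-- In the sensor-revealing game started in `q`, the strategy `π` reaches the final state almost
surely against every strategy of player 2. -/
def HAlmostSureWinning [Finite S] [Finite A] [Finite Sens] (σ₀ : Sens) (ε : ℝ≥0) (hε : ε ≤ 1)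
    (π : G.HStrategy₁ τ) (q : G.HState τ) : Prop :=
  ∀ π₂ : G.HStrategy₂ τ, G.HLegal σ₀ q π₂ →
    ∀ᵐ w ∂(wordLaw (G.nextHStep σ₀ ε hε π π₂ q)), q = .final ∨ ∃ n, (w n).state = .final

/-! ### Using a strategy of the sensor-revealing game in the original game -/

/-- Player 1's belief after a play prefix, if his initial belief is `B₀`. -/
def belief (B₀ : Set S) (ρ : G.Pref) : Set S :=
  ρ.foldl (fun B r => G.Post B r.act ∩ (G.Obs r.state r.query r.attack).1) B₀

/-- The counter after a play prefix. -/
noncomputable def counter (σ₀ : Sens) (τ : ℕ) (ρ : G.Pref) : Counter τ :=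
  ρ.foldl (fun κ r => Counter.update σ₀ κ r.query.1) (Counter.unrevealed τ)

/-- The state of the sensor-revealing game that corresponds to a play prefix. -/
noncomputable def toH (σ₀ : Sens) (τ : ℕ) (B₀ : Set S) (ρ : G.Pref) : G.HState τ :=
  .p1 (G.lastState ρ) (G.belief B₀ ρ) (G.counter σ₀ τ ρ)

/-- The strategy in the original game that keeps track of the state of the sensor-revealing game
and decides as `π` does there. -/
noncomputable def ofH (σ₀ : Sens) (B₀ : Set S) (π : G.HStrategy₁ τ) : G.Strategy₁ :=
  fun ρ => π (G.lastState ρ) (G.belief B₀ ρ) (G.counter σ₀ τ ρ)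

end Game

end SensorGame

/-! Fix an admissible strategy of player 2 in the original game. One round there is three
transitions of the sensor-revealing game, so she can follow the same strategy there (`imitate`).
This is legal because the counter equals `τ` whenever some query of `σ₀` is at least `τ` rounds old.

Call a round mixed if it hits `F` with probability strictly between 0 and 1, and let `m` be the
number of mixed rounds among the first `n`. A play that avoids `F` is reproduced in the
sensor-revealing game with its probability multiplied by `c ^ m`, where `c = 1 - ε`. Hence the mean
of `c ^ m` over plays avoiding `F` is at most the probability that the final state is not reached in
`3 * n` transitions (`lintegral_weight_mul_le`), which tends to zero.

This does not suffice, since `c ^ m` may be small merely because `m` is large: the final state may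
have been reached through the `ε` alone. But a mixed round also hits `F` in the original game, with
probability at least `1 - d` for a uniform `d < 1`, by finiteness. So the mean of `d⁻¹ ^ m` over
plays avoiding `F` is at most 1 (`lintegral_weight_le_one`). Separating `m ≤ N` from `m ≥ N` bounds
the probability of avoiding `F` by `c⁻¹ ^ N` times a null sequence in `n`, plus `d ^ N`. Let `n`,
then `N`, tend to infinity. -/

namespace SensorGame

/-! ### Means with respect to probability mass functions -/

section Mean

variable {X Y : Type*}

/-- The mean of a nonnegative function under a probability mass function. -/
noncomputable def mean (p : PMF X) (g : X → ℝ≥0∞) : ℝ≥0∞ := ∑' x, p x * g x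

@[simp]
theorem mean_pure (a : X) (g : X → ℝ≥0∞) : mean (PMF.pure a) g = g a := by
  rw [mean, tsum_eq_single a] <;> simp +contextual [PMF.pure_apply]

@[simp]
theorem mean_bind (p : PMF X) (q : X → PMF Y) (g : Y → ℝ≥0∞) :
    mean (p.bind q) g = mean p fun x => mean (q x) g := by
  simp only [mean, PMF.bind_apply, ← ENNReal.tsum_mul_right, ← ENNReal.tsum_mul_left]
  rw [ENNReal.tsum_comm]
  simp only [mul_assoc]

@[simp]
theorem mean_map (p : PMF X) (f : X → Y) (g : Y → ℝ≥0∞) :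
    mean (p.map f) g = mean p (g ∘ f) := by
  rw [PMF.map, mean_bind]
  simp [Function.comp_def]

theorem mean_const (p : PMF X) (c : ℝ≥0∞) : mean p (fun _ => c) = c := by
  rw [mean, ENNReal.tsum_mul_right, p.tsum_coe, one_mul]

theorem mean_mono_support (p : PMF X) {f g : X → ℝ≥0∞} (h : ∀ x ∈ p.support, f x ≤ g x) :
    mean p f ≤ mean p g := by
  refine ENNReal.tsum_le_tsum fun x => ?_
  by_cases hx : x ∈ p.support
  · gcongr
    exact h x hx
  · simp [(p.apply_eq_zero_iff x).2 hx]

theorem mean_mono (p : PMF X) {f g : X → ℝ≥0∞} (h : ∀ x, f x ≤ g x) : mean p f ≤ mean p g :=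
  mean_mono_support p fun x _ => h x

theorem mean_const_mul (p : PMF X) (c : ℝ≥0∞) (g : X → ℝ≥0∞) :
    mean p (fun x => c * g x) = c * mean p g := by
  simp only [mean, ← ENNReal.tsum_mul_left]
  exact tsum_congr fun x => by ring

theorem lintegral_toMeasure_eq_mean [Finite X] [MeasurableSpace X] [DiscreteMeasurableSpace X]
    (p : PMF X) (g : X → ℝ≥0∞) : ∫⁻ x, g x ∂p.toMeasure = mean p g := by
  rw [lintegral_countable', mean]
  refine tsum_congr fun x => ?_
  rw [PMF.toMeasure_apply_singleton _ _ (measurableSet_singleton x), mul_comm]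

end Mean

/-! ### Prefixes of the random word -/

section Word

variable {X : Type*}

/-- The first `n` letters of an infinite word. -/
def firstLetters (n : ℕ) (w : ℕ → X) : List X := List.ofFn fun i : Fin n => w i

@[simp]
theorem firstLetters_zero (w : ℕ → X) : firstLetters 0 w = [] := rfl

theorem firstLetters_succ (n : ℕ) (w : ℕ → X) :
    firstLetters (n + 1) w = firstLetters n w ++ [w n] := by
  rw [firstLetters, List.ofFn_succ_last]
  rfl

theorem forall_mem_firstLetters {n : ℕ} {w : ℕ → X} {P : X → Prop} :
    (∀ x ∈ firstLetters n w, P x) ↔ ∀ i < n, P (w i) := by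
  simp [firstLetters, List.mem_ofFn, Fin.forall_iff]

variable [Finite X] [MeasurableSpace X] [DiscreteMeasurableSpace X]

theorem measurable_comp_firstLetters {Y : Type*} [MeasurableSpace Y] (n : ℕ) (f : List X → Y) :
    Measurable fun w : ℕ → X => f (firstLetters n w) := by
  have h : Measurable fun x : Fin n → X => f (List.ofFn x) := Measurable.of_discrete
  exact h.comp (measurable_pi_lambda _ fun i => measurable_pi_apply _)

theorem measurableSet_forall_lt (n : ℕ) (P : X → Prop) :
    MeasurableSet {w : ℕ → X | ∀ i < n, P (w i)} := by
  simpa only [forall_mem_firstLetters] using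
    (measurable_comp_firstLetters n fun l : List X => ∀ x ∈ l, P x).setOf

instance wordLaw_isProbabilityMeasure (next : List X → PMF X) :
    IsProbabilityMeasure (wordLaw next) := by
  have := PMF.toMeasure.isProbabilityMeasure (next [])
  unfold wordLaw
  infer_instance

theorem lintegral_wordLaw_eval_zero (next : List X → PMF X) (f : X → ℝ≥0∞) :
    ∫⁻ w, f (w 0) ∂wordLaw next = mean (next []) f := by
  have hf : Measurable fun w : ℕ → X => f (w 0) :=
    Measurable.of_discrete.comp (measurable_pi_apply 0)
  -- The trajectory kernel started at time 0 leaves the letter number 0 unchanged.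
  have htraj : ∀ x : (Π _ : Finset.Iic 0, X),
      ∫⁻ w, f (w 0) ∂Kernel.traj (X := fun _ => X) (nextKernel next) 0 x =
        f (x ⟨0, Finset.mem_Iic.2 le_rfl⟩) := by
    intro x
    rw [Kernel.lintegral_traj x hf]
    simp [Function.updateFinset]
  rw [wordLaw, Kernel.trajMeasure, Measure.lintegral_bind (Kernel.aemeasurable _) hf.aemeasurable]
  simp only [htraj]
  rw [lintegral_map Measurable.of_discrete (by fun_prop), ← lintegral_toMeasure_eq_mean]
  rfl

/-- The letter that follows the first `n` letters of the random word is drawn according to the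
rule that generates the word. -/
theorem lintegral_firstLetters_succ (next : List X → PMF X) (n : ℕ) (f : List X → ℝ≥0∞) :
    ∫⁻ w, f (firstLetters (n + 1) w) ∂wordLaw next =
      ∫⁻ w, mean (next (firstLetters n w)) (fun x => f (firstLetters n w ++ [x]))
        ∂wordLaw next := by
  -- The first letter comes from the initial law, the others from `nextKernel`.
  cases n with
  | zero =>
    simp only [firstLetters_succ, firstLetters_zero, lintegral_const, measure_univ, mul_one]
    exact lintegral_wordLaw_eval_zero next fun x => f ([] ++ [x])
  | succ n =>
    have := PMF.toMeasure.isProbabilityMeasure (next [])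
    have key := Kernel.map_frestrictLe_trajMeasure_compProd_eq_map_trajMeasure
      (X := fun _ : ℕ => X) (μ₀ := (next []).toMeasure) (κ := nextKernel next) (a := n)
    let g : (Π _ : Finset.Iic n, X) → List X := fun x =>
      List.ofFn fun i : Fin (n + 1) => x ⟨i.1, Finset.mem_Iic.2 (Nat.lt_succ_iff.1 i.2)⟩
    have hg : ∀ w : ℕ → X, g (Preorder.frestrictLe n w) = firstLetters (n + 1) w := fun w => rfl
    have hF : Measurable fun z : (Π _ : Finset.Iic n, X) × X => f (g z.1 ++ [z.2]) :=
      Measurable.of_discrete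
    have h₁ := congrArg (fun μ => ∫⁻ z, f (g z.1 ++ [z.2]) ∂μ) key
    rw [Measure.lintegral_compProd hF, lintegral_map hF (by fun_prop),
      lintegral_map Measurable.of_discrete (by fun_prop)] at h₁
    simp only [hg, ← firstLetters_succ] at h₁
    rw [wordLaw, ← h₁]
    refine lintegral_congr fun w => ?_
    exact (lintegral_toMeasure_eq_mean (next (firstLetters (n + 1) w))
      fun x => f (firstLetters (n + 1) w ++ [x]))

end Word

/-! ### The counter and the observations -/

section Counter

variable {Sens : Type*} (σ₀ : Sens) {τ : ℕ}

theorem Counter.nonneg_update (κ : Counter τ) {γ : Set Sens} (hγ : σ₀ ∈ γ) :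
    0 ≤ (Counter.update σ₀ κ γ).1 := by
  have := κ.2.1
  unfold Counter.update
  split_ifs with h₁ h₂
  · omega
  · exact absurd hγ h₂.2
  · simp only; omega

theorem Counter.min_le_update (κ : Counter τ) (γ : Set Sens) (hκ : 0 ≤ κ.1) :
    min (τ : ℤ) (κ.1 + 1) ≤ (Counter.update σ₀ κ γ).1 := by
  unfold Counter.update
  split_ifs with h₁ h₂
  · omega
  · omega
  · exact min_le_right _ _

/-- A query of the hidden sensor that was made `j` rounds ago forces the counter up to
`min τ j`. -/
theorem Counter.min_le_foldl (l : List (Set Sens)) {t : ℕ} {γ : Set Sens}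
    (ht : l[t]? = some γ) (hγ : σ₀ ∈ γ) :
    min (τ : ℤ) (l.length - 1 - t) ≤
      (l.foldl (Counter.update σ₀) (Counter.unrevealed τ)).1 := by
  induction l using List.reverseRecOn with
  | nil => simp at ht
  | append_singleton l γ' ih =>
    rw [List.foldl_append, List.foldl_cons, List.foldl_nil, List.length_append,
      List.length_singleton]
    rcases lt_trichotomy t l.length with h | h | h
    · rw [List.getElem?_append_left h] at ht
      have h₁ := ih ht
      have h₂ := Counter.min_le_update σ₀
        (l.foldl (Counter.update σ₀) (Counter.unrevealed τ)) γ' (by omega)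
      push_cast
      omega
    · subst h
      simp only [List.getElem?_concat_length, Option.some.injEq] at ht
      subst ht
      have := Counter.nonneg_update σ₀
        (l.foldl (Counter.update σ₀) (Counter.unrevealed τ)) hγ
      push_cast
      omega
    · rw [List.getElem?_eq_none (by simp; omega)] at ht
      simp at ht

end Counter

namespace Game

variable {S A Sens : Type*} (G : Game S A Sens)

theorem lastState_append_singleton (ρ : G.Pref) (r : G.Round) :
    G.lastState (ρ ++ [r]) = r.state := by
  simp [lastState]

theorem belief_append_singleton (B₀ : Set S) (ρ : G.Pref) (r : G.Round) :
    G.belief B₀ (ρ ++ [r]) =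
      G.Post (G.belief B₀ ρ) r.act ∩ (G.Obs r.state r.query r.attack).1 := by
  simp [belief]

theorem counter_append_singleton (σ₀ : Sens) (τ : ℕ) (ρ : G.Pref) (r : G.Round) :
    G.counter σ₀ τ (ρ ++ [r]) = Counter.update σ₀ (G.counter σ₀ τ ρ) r.query.1 := by
  simp [counter]

theorem belief_eq_foldl_observation (B₀ : Set S) (ρ : G.Pref) :
    G.belief B₀ ρ = (G.observation ρ).2.foldl (fun B x => G.Post B x.1 ∩ x.2.2.2.1) B₀ := by
  simp [belief, observation, List.foldl_map]

theorem counter_eq_foldl_observation (σ₀ : Sens) (τ : ℕ) (ρ : G.Pref) :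
    G.counter σ₀ τ ρ = (G.observation ρ).2.foldl
      (fun κ x => Counter.update σ₀ κ x.2.1.1) (Counter.unrevealed τ) := by
  simp [counter, observation, List.foldl_map]

/-- Belief and counter are folds over the observation alone; the last state is not, but a
belief-based strategy ignores it. -/
theorem observationBased_ofH (σ₀ : Sens) {τ : ℕ} (B₀ : Set S) {π : G.HStrategy₁ τ}
    (hπ : G.BeliefBased π) : G.ObservationBased (G.ofH σ₀ B₀ π) := by
  intro ρ ρ' h
  rw [ofH, ofH, G.belief_eq_foldl_observation, G.counter_eq_foldl_observation, h,
    ← G.belief_eq_foldl_observation, ← G.counter_eq_foldl_observation]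
  exact hπ _ _ _ _

/-- When the counter is below the delay, no admissible strategy attacks the hidden sensor. -/
theorem Admissible.notMem_of_counter_lt {σ₀ : Sens} {τ : ℕ} {π₂ : G.Strategy₂}
    (h : G.Admissible σ₀ τ π₂) (ρ : G.Pref) (a : A) (γ₁ : G.Γ₁) (s : S)
    (hκ : (Counter.update σ₀ (G.counter σ₀ τ ρ) γ₁.1).1 < τ) {γ₂ : G.Γ₂}
    (hγ₂ : γ₂ ∈ (π₂ ρ a γ₁ s).support) : σ₀ ∉ γ₂.1 := by
  intro hmem
  obtain ⟨t, ht, γ, hγ, hσ⟩ := h ρ a γ₁ s γ₂ hγ₂ hmem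
  -- The current query has index `ρ.length`, so a query at `t` with `t + τ ≤ ρ.length` forces the
  -- updated counter up to `τ`.
  have key := Counter.min_le_foldl σ₀ (τ := τ)
    ((ρ.map Round.query ++ [γ₁]).map Subtype.val) (t := t) (γ := γ.1)
    (by rw [List.getElem?_map, Option.mem_def.1 hγ]; rfl) hσ
  have hfold : ((ρ.map Round.query ++ [γ₁]).map Subtype.val).foldl (Counter.update σ₀)
      (Counter.unrevealed τ) = Counter.update σ₀ (G.counter σ₀ τ ρ) γ₁.1 := by
    simp [counter, List.foldl_map]
  rw [hfold] at key
  simp at key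
  omega

/-! ### Plays without a visit to the goal -/

/-- From `s`, the action `a` leads to the goal with a probability other than zero and one. -/
def Mixed (s : S) (a : A) : Prop := ¬ G.Post {s} a ⊆ G.F ∧ (G.Post {s} a ∩ G.F).Nonempty

open Classical in
/-- The number of rounds of `h`, played after the prefix `ρ`, in which a visit to the goal was
neither certain nor impossible. -/
noncomputable def mixedCount : G.Pref → List G.Round → ℕ
  | _, [] => 0
  | ρ, r :: h => (if G.Mixed (G.lastState ρ) r.act then 1 else 0) + mixedCount (ρ ++ [r]) h

open Classical in
theorem mixedCount_append_singleton (ρ : G.Pref) (h : List G.Round) (r : G.Round) :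
    G.mixedCount ρ (h ++ [r]) =
      G.mixedCount ρ h + if G.Mixed (G.lastState (ρ ++ h)) r.act then 1 else 0 := by
  induction h generalizing ρ with
  | nil => simp [mixedCount]
  | cons r' h ih =>
    have := ih (ρ ++ [r'])
    simp only [List.append_assoc, List.singleton_append] at this
    simp [mixedCount, this, add_assoc]

open Classical in
/-- The indicator of the plays without a visit to the goal, with a factor `c` for each mixed
round. -/
noncomputable def weight (c : ℝ≥0∞) (ρ : G.Pref) (h : List G.Round) : ℝ≥0∞ :=
  if ∀ r ∈ h, r.state ∉ G.F then c ^ G.mixedCount ρ h else 0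

open Classical in
/-- The factor that a round from `s` by `a` to `s'` contributes to the weight of a play. -/
noncomputable def stepWeight (c : ℝ≥0∞) (s : S) (a : A) (s' : S) : ℝ≥0∞ :=
  if s' ∈ G.F then 0 else if G.Mixed s a then c else 1

theorem weight_append_singleton (c : ℝ≥0∞) (ρ : G.Pref) (h : List G.Round) (r : G.Round) :
    G.weight c ρ (h ++ [r]) =
      G.weight c ρ h * G.stepWeight c (G.lastState (ρ ++ h)) r.act r.state := by
  classical
  simp only [weight, stepWeight, mixedCount_append_singleton, List.forall_mem_append,
    List.forall_mem_singleton]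
  split_ifs <;> simp_all [pow_succ]

theorem weight_nil (c : ℝ≥0∞) (ρ : G.Pref) : G.weight c ρ [] = 1 := by
  simp [weight, mixedCount]

/-- The first summand is at least 1 if there are at most `N` mixed rounds, the second if there are
at least `N`. -/
theorem one_le_weight_add_weight {c d : ℝ≥0∞} (hc₀ : c ≠ 0) (hc₁ : c ≤ 1) (hd₀ : d ≠ 0)
    (hd₁ : d ≤ 1) (ρ : G.Pref) {h : List G.Round} (hh : ∀ r ∈ h, r.state ∉ G.F) (N : ℕ) :
    1 ≤ c⁻¹ ^ N * G.weight c ρ h + d ^ N * G.weight d⁻¹ ρ h := by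
  rw [weight, if_pos hh, weight, if_pos hh]
  rcases le_total (G.mixedCount ρ h) N with hN | hN
  · calc 1 = c⁻¹ ^ N * c ^ N := by
          rw [← mul_pow, ENNReal.inv_mul_cancel hc₀ (ne_top_of_le_ne_top (by simp) hc₁), one_pow]
      _ ≤ c⁻¹ ^ N * c ^ G.mixedCount ρ h := by
          gcongr c⁻¹ ^ N * ?_
          exact pow_le_pow_right_of_le_one' hc₁ hN
      _ ≤ _ := le_self_add
  · calc 1 = d ^ N * d⁻¹ ^ N := by
          rw [← mul_pow, ENNReal.mul_inv_cancel hd₀ (ne_top_of_le_ne_top (by simp) hd₁), one_pow]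
      _ ≤ d ^ N * d⁻¹ ^ G.mixedCount ρ h := by
          gcongr
          exact ENNReal.one_le_inv.2 hd₁
      _ ≤ _ := le_add_self

/-- In a mixed round the factor `d⁻¹` is paid for by the probability, at most `d`, of missing the
goal. -/
theorem mean_stepWeight_le_one {d : ℝ≥0∞} (hd₀ : d ≠ 0) (hd₁ : d < 1)
    (hd : ∀ s a, G.Mixed s a → (G.P s a).toOuterMeasure G.Fᶜ ≤ d) (s : S) (a : A) :
    mean (G.P s a) (G.stepWeight d⁻¹ s a) ≤ 1 := by
  classical
  by_cases hm : G.Mixed s a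
  · have : mean (G.P s a) (G.stepWeight d⁻¹ s a) =
        d⁻¹ * (G.P s a).toOuterMeasure G.Fᶜ := by
      rw [PMF.toOuterMeasure_apply, mean, ← ENNReal.tsum_mul_left]
      refine tsum_congr fun s' => ?_
      by_cases hs : s' ∈ G.F <;> simp [stepWeight, hs, hm, mul_comm]
    rw [this]
    calc d⁻¹ * (G.P s a).toOuterMeasure G.Fᶜ ≤ d⁻¹ * d := by gcongr; exact hd s a hm
      _ = 1 := ENNReal.inv_mul_cancel hd₀ hd₁.ne_top
  · calc mean (G.P s a) (G.stepWeight d⁻¹ s a) ≤ mean (G.P s a) (fun _ => 1) :=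
          mean_mono _ fun s' => by unfold stepWeight; split_ifs <;> simp
      _ = 1 := mean_const _ _

/-- A maximum over finitely many pairs, each value below 1; the `2⁻¹` only keeps the bound away from
zero. -/
theorem exists_mixed_bound [Finite S] [Finite A] :
    ∃ d : ℝ≥0∞, d ≠ 0 ∧ d < 1 ∧
      ∀ s a, G.Mixed s a → (G.P s a).toOuterMeasure G.Fᶜ ≤ d := by
  classical
  have := Fintype.ofFinite S
  have := Fintype.ofFinite A
  let g : S × A → ℝ≥0∞ := fun x =>
    if G.Mixed x.1 x.2 then (G.P x.1 x.2).toOuterMeasure G.Fᶜ else 0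
  refine ⟨max 2⁻¹ (Finset.univ.sup g), ?_, ?_, fun s a hm => ?_⟩
  · exact (lt_of_lt_of_le (by simp) (le_max_left _ _)).ne'
  · refine max_lt (by simp) ((Finset.sup_lt_iff (by simp)).2 fun x _ => ?_)
    simp only [g]
    split_ifs with hm
    -- If the complement of the goal had probability one, it would contain the support, hence the
    -- goal state `s'`.
    · obtain ⟨s', ⟨s, rfl, hs'⟩, hF⟩ := hm.2
      refine lt_of_le_of_ne ((PMF.toOuterMeasure_mono _ (Set.subset_univ _)).trans
        ((PMF.toOuterMeasure_apply_eq_one_iff _ _).2 (Set.subset_univ _)).le) fun h => ?_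
      exact (PMF.toOuterMeasure_apply_eq_one_iff _ _).1 h
        ((PMF.mem_support_iff _ _).2 hs'.ne') hF
    · simp
  · refine le_trans ?_ (le_max_right _ _)
    refine le_trans ?_ (Finset.le_sup (Finset.mem_univ (s, a)))
    simp [g, hm]

section

variable [Finite S] [Finite A] [Finite Sens]

/-- The weight is a nonnegative supermartingale that starts at 1. -/
theorem lintegral_weight_le_one {d : ℝ≥0∞} (hd₀ : d ≠ 0) (hd₁ : d < 1)
    (hd : ∀ s a, G.Mixed s a → (G.P s a).toOuterMeasure G.Fᶜ ≤ d)
    (π₁ : G.Strategy₁) (π₂ : G.Strategy₂) (ρ : G.Pref) (n : ℕ) :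
    ∫⁻ w, G.weight d⁻¹ ρ (firstLetters n w)
      ∂wordLaw (fun h => G.nextRound π₁ π₂ (ρ ++ h)) ≤ 1 := by
  induction n with
  | zero => simp [weight_nil]
  | succ n ih =>
    rw [lintegral_firstLetters_succ]
    refine le_trans (lintegral_mono fun w => ?_) ih
    simp only [weight_append_singleton]
    rw [mean_const_mul]
    refine mul_le_of_le_one_right' ?_
    simp only [nextRound, mean_bind, mean_map, Function.comp_def, mean_const]
    refine (mean_mono _ fun (c : A × G.Γ₁) => G.mean_stepWeight_le_one hd₀ hd₁ hd _ c.1).trans ?_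
    rw [mean_const]

end

/-! ### The plays of the sensor-revealing game that correspond to plays of the original game -/

section Simulation

variable (σ₀ : Sens) {τ : ℕ} (B₀ : Set S)

/-- The move of player 1 in the sensor-revealing game that corresponds to his action after `ρ`. -/
noncomputable def controlStep (τ : ℕ) (ρ : G.Pref) (a : A) (γ₁ : G.Γ₁) : G.HStep τ :=
  ⟨.control a γ₁, .nature (G.lastState ρ) (G.Post (G.belief B₀ ρ) a) a γ₁
    (Counter.update σ₀ (G.counter σ₀ τ ρ) γ₁.1)⟩

/-- The move of nature in the sensor-revealing game that corresponds to the new state `s`. -/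
noncomputable def chanceStep (τ : ℕ) (ρ : G.Pref) (a : A) (γ₁ : G.Γ₁) (s : S) : G.HStep τ :=
  ⟨.chance, .p2 s (G.Post (G.belief B₀ ρ) a) γ₁ (Counter.update σ₀ (G.counter σ₀ τ ρ) γ₁.1)⟩

/-- The move of player 2 in the sensor-revealing game that ends the round `r`. -/
noncomputable def attackStep (τ : ℕ) (ρ : G.Pref) (r : G.Round) : G.HStep τ :=
  ⟨.attack r.attack, G.toH σ₀ τ B₀ (ρ ++ [r])⟩

/-- The play of the sensor-revealing game that corresponds to the rounds `h` after `ρ`. -/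
noncomputable def expand (τ : ℕ) : G.Pref → List G.Round → List (G.HStep τ)
  | _, [] => []
  | ρ, r :: h =>
    G.controlStep σ₀ B₀ τ ρ r.act r.query :: G.chanceStep σ₀ B₀ τ ρ r.act r.query r.state ::
      G.attackStep σ₀ B₀ τ ρ r :: expand τ (ρ ++ [r]) h

theorem expand_append_singleton (ρ : G.Pref) (h : List G.Round) (r : G.Round) :
    G.expand σ₀ B₀ τ ρ (h ++ [r]) = G.expand σ₀ B₀ τ ρ h ++
      [G.controlStep σ₀ B₀ τ (ρ ++ h) r.act r.query] ++
      [G.chanceStep σ₀ B₀ τ (ρ ++ h) r.act r.query r.state] ++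
      [G.attackStep σ₀ B₀ τ (ρ ++ h) r] := by
  induction h generalizing ρ with
  | nil => simp [expand]
  | cons r' h ih =>
    have := ih (ρ ++ [r'])
    simp only [List.append_assoc, List.singleton_append] at this
    simp [expand, this]

theorem lastH_append_singleton (q : G.HState τ) (h : List (G.HStep τ)) (x : G.HStep τ) :
    G.lastH q (h ++ [x]) = x.state := by
  simp [lastH]

theorem lastH_expand (ρ : G.Pref) (h : List G.Round) :
    G.lastH (G.toH σ₀ τ B₀ ρ) (G.expand σ₀ B₀ τ ρ h) = G.toH σ₀ τ B₀ (ρ ++ h) := by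
  induction h using List.reverseRecOn with
  | nil => simp [expand, lastH]
  | append_singleton h r _ =>
    rw [expand_append_singleton, lastH_append_singleton, attackStep, List.append_assoc]

theorem state_ne_final_of_mem_expand (ρ : G.Pref) (h : List G.Round) :
    ∀ x ∈ G.expand σ₀ B₀ τ ρ h, x.state ≠ .final := by
  induction h generalizing ρ with
  | nil => simp [expand]
  | cons r h ih => simpa [expand, controlStep, chanceStep, attackStep, toH] using ih (ρ ++ [r])

/-- The play of the sensor-revealing game that corresponds to the rounds `x.1` after `ρ`, followed
by an action of player 1 and a new state. -/
noncomputable def expandPending (τ : ℕ) (ρ : G.Pref) (x : List G.Round × A × G.Γ₁ × S) :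
    List (G.HStep τ) :=
  G.expand σ₀ B₀ τ ρ x.1 ++ [G.controlStep σ₀ B₀ τ (ρ ++ x.1) x.2.1 x.2.2.1] ++
    [G.chanceStep σ₀ B₀ τ (ρ ++ x.1) x.2.1 x.2.2.1 x.2.2.2]

/-- The recorded moves and states determine every round. This makes `imitate` well defined: player 2
can recover the original history. -/
theorem expandPending_injective (ρ : G.Pref) :
    Function.Injective (G.expandPending σ₀ B₀ τ ρ) := by
  rintro ⟨h, a, γ, s⟩ ⟨h', a', γ', s'⟩ heq
  simp only [expandPending] at heq
  induction h generalizing ρ h' with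
  | nil =>
    cases h' with
    | nil => simp_all [expand, controlStep, chanceStep]
    | cons r' h' => simp [expand] at heq
  | cons r h ih =>
    cases h' with
    | nil => simp [expand] at heq
    | cons r' h' =>
      have hr : r = r' := by
        cases r; cases r'
        simp_all [expand, controlStep, chanceStep, attackStep]
      subst hr
      have := ih (ρ ++ [r]) h' (by simpa [expand] using heq)
      simp_all

/-- The strategy of player 2 in the sensor-revealing game that imitates, in the plays from
`G.toH σ₀ τ B₀ ρ`, the strategy `π₂` of the original game, with the default attack `γ₂`. -/
noncomputable def imitate (τ : ℕ) (ρ : G.Pref) (π₂ : G.Strategy₂) (γ₂ : G.Γ₂) : G.HStrategy₂ τ :=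
  Function.extend (G.expandPending σ₀ B₀ τ ρ)
    (fun x => π₂ (ρ ++ x.1) x.2.1 x.2.2.1 x.2.2.2) fun _ => PMF.pure γ₂

theorem imitate_expandPending (ρ : G.Pref) (π₂ : G.Strategy₂) (γ₂ : G.Γ₂)
    (x : List G.Round × A × G.Γ₁ × S) :
    G.imitate σ₀ B₀ τ ρ π₂ γ₂ (G.expandPending σ₀ B₀ τ ρ x) =
      π₂ (ρ ++ x.1) x.2.1 x.2.2.1 x.2.2.2 :=
  (G.expandPending_injective σ₀ B₀ ρ).extend_apply _ _ _

/-- On histories that imitate a play, legality comes from admissibility and the counter; on all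
others the default attack avoids `σ₀`. -/
theorem hLegal_imitate (ρ : G.Pref) {π₂ : G.Strategy₂} (hπ₂ : G.Admissible σ₀ τ π₂) {γ₂ : G.Γ₂}
    (hγ₂ : σ₀ ∉ γ₂.1) :
    G.HLegal σ₀ (G.toH σ₀ τ B₀ ρ) (G.imitate σ₀ B₀ τ ρ π₂ γ₂) := by
  intro h s B γ₁ κ hlast hκ γ hγ
  by_cases hx : ∃ x, G.expandPending σ₀ B₀ τ ρ x = h
  · obtain ⟨x, rfl⟩ := hx
    rw [imitate_expandPending] at hγ
    rw [expandPending, lastH_append_singleton, chanceStep, HState.p2.injEq] at hlast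
    obtain ⟨-, -, -, rfl⟩ := hlast
    exact hπ₂.notMem_of_counter_lt _ _ _ _ _ hκ hγ
  · rw [imitate, Function.extend_apply' _ _ _ hx, PMF.support_pure, Set.mem_singleton_iff] at hγ
    rwa [hγ]

/-- A round of the original game without a visit to the goal is imitated in the sensor-revealing
game, at the cost of the factor `1 - ε` if the round is mixed. -/
theorem mean_nextRound_le (ε : ℝ≥0) (hε : ε ≤ 1) (π : G.HStrategy₁ τ) (π₂ : G.Strategy₂)
    (γ₂ : G.Γ₂) (ρ : G.Pref) (h : List G.Round) (f : List (G.HStep τ) → ℝ≥0∞) :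
    let next := G.nextHStep σ₀ ε hε π (G.imitate σ₀ B₀ τ ρ π₂ γ₂) (G.toH σ₀ τ B₀ ρ)
    mean (G.nextRound (G.ofH σ₀ B₀ π) π₂ (ρ ++ h)) (fun r =>
        G.stepWeight (1 - ε : ℝ≥0) (G.lastState (ρ ++ h)) r.act r.state *
          f (G.expand σ₀ B₀ τ ρ (h ++ [r]))) ≤
      mean (next (G.expand σ₀ B₀ τ ρ h)) fun x => mean (next (G.expand σ₀ B₀ τ ρ h ++ [x])) fun y =>
        mean (next (G.expand σ₀ B₀ τ ρ h ++ [x] ++ [y])) fun z =>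
          f (G.expand σ₀ B₀ τ ρ h ++ [x] ++ [y] ++ [z]) := by
  classical
  intro next
  have h₁ : next (G.expand σ₀ B₀ τ ρ h) =
      (G.ofH σ₀ B₀ π (ρ ++ h)).map fun c => G.controlStep σ₀ B₀ τ (ρ ++ h) c.1 c.2 := by
    simp only [next, nextHStep, lastH_expand]
    simp only [toH, δ₁, PMF.pure_map]
    rfl
  have h₂ : ∀ a γ₁, next (G.expand σ₀ B₀ τ ρ h ++ [G.controlStep σ₀ B₀ τ (ρ ++ h) a γ₁]) =
      (G.δN ε hε (G.lastState (ρ ++ h)) (G.Post (G.belief B₀ (ρ ++ h)) a) a γ₁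
        (Counter.update σ₀ (G.counter σ₀ τ (ρ ++ h)) γ₁.1)).map fun q => ⟨.chance, q⟩ := by
    intro a γ₁
    simp only [next, nextHStep, lastH_append_singleton, controlStep]
  have h₃ : ∀ a γ₁ s, next (G.expand σ₀ B₀ τ ρ h ++ [G.controlStep σ₀ B₀ τ (ρ ++ h) a γ₁] ++
      [G.chanceStep σ₀ B₀ τ (ρ ++ h) a γ₁ s]) =
      (π₂ (ρ ++ h) a γ₁ s).map fun γ => G.attackStep σ₀ B₀ τ (ρ ++ h) ⟨a, γ₁, s, γ⟩ := by
    intro a γ₁ s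
    have := G.imitate_expandPending σ₀ B₀ (τ := τ) ρ π₂ γ₂ (h, a, γ₁, s)
    simp only [expandPending] at this
    simp only [next, nextHStep, lastH_append_singleton, this]
    simp only [chanceStep, δ₂, PMF.pure_map, attackStep, toH, lastState_append_singleton,
      belief_append_singleton, counter_append_singleton]
    rfl
  rw [h₁, nextRound, mean_bind, mean_map]
  refine mean_mono _ fun ⟨a, γ₁⟩ => ?_
  simp only [Function.comp_apply, mean_bind, mean_map, h₂, Function.comp_def,
    expand_append_singleton, mean_const_mul]
  set g : S → ℝ≥0∞ := fun s => mean (π₂ (ρ ++ h) a γ₁ s) fun γ =>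
    f (G.expand σ₀ B₀ τ ρ h ++ [G.controlStep σ₀ B₀ τ (ρ ++ h) a γ₁] ++
      [G.chanceStep σ₀ B₀ τ (ρ ++ h) a γ₁ s] ++ [G.attackStep σ₀ B₀ τ (ρ ++ h) ⟨a, γ₁, s, γ⟩])
    with hg
  have h₄ : mean ((G.P (G.lastState (ρ ++ h)) a).map fun s' => HState.p2 s'
      (G.Post (G.belief B₀ (ρ ++ h)) a) γ₁ (Counter.update σ₀ (G.counter σ₀ τ (ρ ++ h)) γ₁.1))
      (fun q => mean (next (G.expand σ₀ B₀ τ ρ h ++ [G.controlStep σ₀ B₀ τ (ρ ++ h) a γ₁] ++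
        [⟨.chance, q⟩])) fun z => f (G.expand σ₀ B₀ τ ρ h ++
          [G.controlStep σ₀ B₀ τ (ρ ++ h) a γ₁] ++ [⟨.chance, q⟩] ++ [z])) =
      mean (G.P (G.lastState (ρ ++ h)) a) g := by
    rw [mean_map]
    refine congrArg _ (funext fun s => ?_)
    have := h₃ a γ₁ s
    rw [chanceStep] at this
    simp only [Function.comp_apply, this, mean_map, hg]
    rfl
  set s := G.lastState (ρ ++ h)
  unfold δN
  split_ifs with hF hd
  -- The goal is hit for certain, so the left side vanishes.
  · calc _ ≤ mean (G.P s a) (fun _ => 0) := mean_mono_support _ fun s' hs' => by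
          have : s' ∈ G.F := hF ⟨s, rfl, pos_iff_ne_zero.2 hs'⟩
          simp [stepWeight, this]
      _ = 0 := mean_const _ _
      _ ≤ _ := zero_le
  -- The goal cannot be hit: both games draw the new state from the same law.
  · rw [h₄]
    refine mean_mono _ fun s' => mul_le_of_le_one_left' ?_
    have : ¬ G.Mixed s a := fun hm => hm.2.ne_empty hd
    unfold stepWeight
    split_ifs <;> simp
  -- Mixed case: the branch to the final state is dropped; the other one has the factor `1 - ε`.
  · rw [mean_bind, mean.eq_def (coin ε hε), tsum_bool]
    refine le_trans ?_ le_self_add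
    simp only [Bool.false_eq_true, if_false]
    rw [h₄]
    have hc : coin ε hε false = ((1 - ε : ℝ≥0) : ℝ≥0∞) := by simp [coin]
    rw [hc, ← mean_const_mul]
    refine mean_mono _ fun s' => ?_
    have : G.Mixed s a := ⟨hF, Set.nonempty_iff_ne_empty.2 hd⟩
    unfold stepWeight
    split_ifs <;> simp [hg]

end Simulation

/-! ### Comparison of the laws of the two games, and the limit argument -/

variable [Finite S] [Finite A] [Finite Sens]

/-- The last round is peeled off as three transitions. The test function `f` is arbitrary so that
the induction hypothesis applies to its conditional mean over them. Only an inequality holds, since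
the sensor-revealing game may also continue through goal states. -/
theorem lintegral_weight_mul_le (σ₀ : Sens) {τ : ℕ} (B₀ : Set S) (ε : ℝ≥0) (hε : ε ≤ 1)
    (π : G.HStrategy₁ τ) (π₂ : G.Strategy₂) (γ₂ : G.Γ₂) (ρ : G.Pref) (n : ℕ)
    (f : List (G.HStep τ) → ℝ≥0∞) :
    ∫⁻ w, G.weight (1 - ε : ℝ≥0) ρ (firstLetters n w) *
        f (G.expand σ₀ B₀ τ ρ (firstLetters n w))
      ∂wordLaw (fun h => G.nextRound (G.ofH σ₀ B₀ π) π₂ (ρ ++ h)) ≤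
    ∫⁻ w, f (firstLetters (3 * n) w) ∂wordLaw
      (G.nextHStep σ₀ ε hε π (G.imitate σ₀ B₀ τ ρ π₂ γ₂) (G.toH σ₀ τ B₀ ρ)) := by
  set next := G.nextHStep σ₀ ε hε π (G.imitate σ₀ B₀ τ ρ π₂ γ₂) (G.toH σ₀ τ B₀ ρ)
  induction n generalizing f with
  | zero => simp [weight_nil, expand]
  | succ n ih =>
    rw [show 3 * (n + 1) = 3 * n + 1 + 1 + 1 by ring, lintegral_firstLetters_succ _ _ f,
      lintegral_firstLetters_succ _ _ fun l => mean (next l) fun x => f (l ++ [x]),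
      lintegral_firstLetters_succ _ _ fun l => mean (next l) fun x =>
        mean (next (l ++ [x])) fun y => f (l ++ [x] ++ [y]),
      lintegral_firstLetters_succ _ n fun l => G.weight (1 - ε : ℝ≥0) ρ l *
        f (G.expand σ₀ B₀ τ ρ l)]
    refine le_trans (lintegral_mono fun w => ?_) (ih fun l => mean (next l) fun x =>
      mean (next (l ++ [x])) fun y => mean (next (l ++ [x] ++ [y])) fun z =>
        f (l ++ [x] ++ [y] ++ [z]))
    simp only [weight_append_singleton, mul_assoc]
    rw [mean_const_mul]
    gcongr
    exact G.mean_nextRound_le σ₀ B₀ ε hε π π₂ γ₂ ρ _ f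

open Filter Topology in
/-- If the final state is reached almost surely, then the probability that it is not reached
within `n` transitions tends to zero. -/
theorem tendsto_measure_not_final {τ : ℕ} (μ : Measure (ℕ → G.HStep τ)) [IsFiniteMeasure μ]
    (h : ∀ᵐ w ∂μ, ∃ n, (w n).state = .final) :
    Tendsto (fun n => μ {w | ∀ i < n, (w i).state ≠ .final}) atTop (𝓝 0) := by
  have key := tendsto_measure_iInter_atTop (μ := μ)
    (fun n => (measurableSet_forall_lt n fun x : G.HStep τ => x.state ≠ .final).nullMeasurableSet)
    (fun m n hmn w hw i hi => hw i (hi.trans_le hmn)) ⟨0, measure_ne_top _ _⟩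
  rw [ae_iff] at h
  rwa [measure_mono_null (fun w hw => ?_) h] at key
  simp only [Set.mem_iInter, Set.mem_ofPred_eq, not_exists] at hw ⊢
  exact fun n => hw (n + 1) n n.lt_succ_self

open Filter Topology in
theorem almostSureWinning_ofH (σ₀ : Sens) (hattack : ∃ γ₂ ∈ G.Γ₂, σ₀ ∉ γ₂) {τ : ℕ} (B₀ : Set S)
    (ε : ℝ≥0) (hε : ε < 1) (π : G.HStrategy₁ τ) (ρ : G.Pref)
    (hwin : G.HAlmostSureWinning σ₀ ε hε.le π (G.toH σ₀ τ B₀ ρ)) :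
    G.AlmostSureWinning σ₀ τ (G.ofH σ₀ B₀ π) ρ := by
  classical
  intro π₂ hπ₂
  obtain ⟨γ₂, hγ₂, hσ⟩ := hattack
  have hH := hwin _ (G.hLegal_imitate σ₀ B₀ ρ hπ₂ (γ₂ := ⟨γ₂, hγ₂⟩) hσ)
  have hlim := G.tendsto_measure_not_final _ (hH.mono fun w hw => hw.resolve_left (by simp [toH]))
  set ν := wordLaw (G.nextHStep σ₀ ε hε.le π (G.imitate σ₀ B₀ τ ρ π₂ ⟨γ₂, hγ₂⟩)
    (G.toH σ₀ τ B₀ ρ))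
  set μ := wordLaw fun h => G.nextRound (G.ofH σ₀ B₀ π) π₂ (ρ ++ h)
  obtain ⟨d, hd₀, hd₁, hd⟩ := G.exists_mixed_bound
  set c : ℝ≥0∞ := ((1 - ε : ℝ≥0) : ℝ≥0∞) with hc
  have hc₀ : c ≠ 0 := by simpa [hc, tsub_eq_zero_iff_le] using hε
  have hc₁ : c ≤ 1 := by simp [hc]
  have hweight : ∀ n, ∫⁻ w, G.weight c ρ (firstLetters n w) ∂μ ≤
      ν {w | ∀ i < 3 * n, (w i).state ≠ .final} := by
    intro n
    -- The test function is the indicator that the final state has not occurred; it equals 1 on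
    -- every expanded play.
    have key := G.lintegral_weight_mul_le σ₀ B₀ ε hε.le π π₂ ⟨γ₂, hγ₂⟩ ρ n
      fun l => if ∀ x ∈ l, x.state ≠ .final then 1 else 0
    simp only [if_pos (G.state_ne_final_of_mem_expand σ₀ B₀ ρ _), mul_one,
      forall_mem_firstLetters] at key
    refine key.trans_eq ?_
    rw [← lintegral_indicator_one (measurableSet_forall_lt _ fun x : G.HStep τ => x.state ≠ .final)]
    simp only [Set.indicator_apply, Set.mem_ofPred_eq, Pi.one_apply, ν]
  have hbound : ∀ N n, μ {w | ∀ i, (w i).state ∉ G.F} ≤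
      c⁻¹ ^ N * ν {w | ∀ i < 3 * n, (w i).state ≠ .final} + d ^ N := by
    intro N n
    calc μ {w | ∀ i, (w i).state ∉ G.F}
        ≤ ∫⁻ w, c⁻¹ ^ N * G.weight c ρ (firstLetters n w) +
          d ^ N * G.weight d⁻¹ ρ (firstLetters n w) ∂μ := by
          have hsub : {w : ℕ → G.Round | ∀ i, (w i).state ∉ G.F} ⊆
              {w | ∀ i < n, (w i).state ∉ G.F} := fun w hw i _ => hw i
          refine (measure_mono hsub).trans ?_
          rw [← lintegral_indicator_one
            (measurableSet_forall_lt n fun r : G.Round => r.state ∉ G.F)]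
          refine lintegral_mono fun w => ?_
          rw [Set.indicator_apply]
          split_ifs with hw
          · exact G.one_le_weight_add_weight hc₀ hc₁ hd₀ hd₁.le ρ (forall_mem_firstLetters.2 hw) N
          · exact zero_le
      _ = c⁻¹ ^ N * ∫⁻ w, G.weight c ρ (firstLetters n w) ∂μ +
          d ^ N * ∫⁻ w, G.weight d⁻¹ ρ (firstLetters n w) ∂μ := by
          rw [lintegral_add_left ((measurable_comp_firstLetters n _).const_mul _),
            lintegral_const_mul _ (measurable_comp_firstLetters n _),
            lintegral_const_mul _ (measurable_comp_firstLetters n _)]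
      _ ≤ _ := by
          gcongr
          · exact hweight n
          · exact mul_le_of_le_one_right' (G.lintegral_weight_le_one hd₀ hd₁ hd _ _ _ _)
  have hN : ∀ N, μ {w | ∀ i, (w i).state ∉ G.F} ≤ d ^ N := by
    intro N
    have h₁ : Tendsto (fun n : ℕ => 3 * n) atTop atTop :=
      tendsto_atTop_mono (fun n => by simp only [id]; omega) tendsto_id
    -- For fixed `N` the constant `c⁻¹ ^ N` is finite because `ε < 1`, so the first term tends to
    -- zero with `n`.
    have h₂ := (ENNReal.Tendsto.const_mul (hlim.comp h₁)
      (Or.inr (ENNReal.pow_ne_top (ENNReal.inv_ne_top.2 hc₀) (n := N)))).add_const (d ^ N)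
    rw [mul_zero, zero_add] at h₂
    exact ge_of_tendsto' h₂ (hbound N)
  have hzero : μ {w | ∀ i, (w i).state ∉ G.F} = 0 :=
    le_antisymm (ge_of_tendsto' (ENNReal.tendsto_pow_atTop_nhds_zero_of_lt_one hd₁) hN) zero_le
  rw [ae_iff]
  refine measure_mono_null (fun w hw => ?_) hzero
  intro i hi
  exact hw <| Or.inr (Or.inr ⟨i, hi⟩)

end Game

end SensorGame

theorem mainTheorem4 {S A Sens : Type*} [Finite S] [Finite A] [Finite Sens]
    (G : SensorGame.Game S A Sens) (σ₀ : Sens)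
    (hattack : ∃ γ₂ ∈ G.Γ₂, σ₀ ∉ γ₂)
    (τ : ℕ) (B₀ : Set S) (ε : ℝ≥0) (hε₀ : 0 < ε) (hε₁ : ε < 1)
    (π : G.HStrategy₁ τ) (hπ : G.BeliefBased π) :
    G.ObservationBased (G.ofH σ₀ B₀ π) ∧
    (G.HAlmostSureWinning σ₀ ε hε₁.le π (G.initialH τ B₀) →
      G.AlmostSureWinning σ₀ τ (G.ofH σ₀ B₀ π) []) ∧
    (∀ ρ : G.Pref, G.HAlmostSureWinning σ₀ ε hε₁.le π (G.toH σ₀ τ B₀ ρ) →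
      G.AlmostSureWinning σ₀ τ (G.ofH σ₀ B₀ π) ρ) := by
  have key := fun ρ => G.almostSureWinning_ofH σ₀ hattack B₀ ε hε₁ π ρ
  exact ⟨G.observationBased_ofH σ₀ B₀ hπ, key [], key⟩
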